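/- Let $\Omega=\{0,1\}^{\mathbb N}$, let $x\Omega$ be the set of infinite sequences beginning with the binary word $x$, and let $\mathcal M(\Omega)$ be the set of Borel probability measures on $\Omega$; write $P(x)=P(x\Omega)$. A basic set in $\mathcal M(\Omega)$ is the set of all $P$ satisfying finitely many conditions $u<P(y)<v$ with $y$ a binary word and $u,v\in\mathbb Q$. A function $t\colon\Omega\to[0,\infty]$ is lower semicomputable if there is an algorithm that, given a rational $r$, enumerates binary words $x$ such that $\{\omega: t(\omega)>r\}$ is the union of the intervals $x\Omega$. A function $t\colon\Omega\times\mathcal M(\Omega)\to[0,\infty]$ is lower semicomputable if there is an algorithm that, given a rational $r$, enumerates products $x\Omega\times\beta$ ($x$ a binary word, $\beta$ a basic set in $\mathcal M(\Omega)$) whose union is $\{(\omega,P): t(\omega,P)>r\}$. A sequence $\omega\in\Omega$ is blindly random with respect to $P\in\mathcal M(\Omega)$ if $t(\omega)<\infty$ for every lower semicomputable $t\colon\Omega\to[0,\infty]$ (computed without any oracle) with $\int t\,dP\le 1$. A uniform test is a lower semicomputable $t\colon\Omega\times\mathcal M(\Omega)\to[0,\infty]$ such that $\int t(\omega,P)\,dP(\omega)\le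 1$ for every $P\in\mathcal M(\Omega)$. A sequence $\omega$ is uniformly random with respect to $P$ if $t(\omega,P)<\infty$ for every uniform test $t$ (equivalently, for a universal uniform test, i.e. one that is maximal up to a constant factor). Theorem. There exist a measure $P\in\mathcal M(\Omega)$ and a sequence $\omega\in\Omega$ such that $\omega$ is blindly random with respect to $P$ but not uniformly random with respect to $P$. -/

import Mathlib

open MeasureTheory
open scoped ENNReal NNReal

namespace AlgRand

/-- Infinite binary sequences, with Mathlib's product topology and product `σ`-algebra. -/
abbrev Cantor : Type := ℕ → Bool

/-- The interval `xΩ` of all infinite sequences that begin with the binary word `x`. -/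
def cylinder (x : List Bool) : Set Cantor :=
  {ω | ∀ (i : ℕ) (h : i < x.length), ω i = x[i]}

/-- Rational numbers as finite objects: the triple `(a, b, c)` denotes `(a - b) / (c + 1)`. -/
abbrev RatCode : Type := ℕ × ℕ × ℕ

/-- The rational number denoted by a code. -/
def RatCode.val (q : RatCode) : ℚ := ((q.1 : ℚ) - (q.2.1 : ℚ)) / ((q.2.2 : ℚ) + 1)

/-- Every rational number has a code. -/
theorem RatCode.val_surjective : Function.Surjective RatCode.val := by
  intro r
  refine ⟨(r.num.toNat, (-r.num).toNat, r.den - 1), ?_⟩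
  have h1 : ((r.num.toNat : ℤ) - ((-r.num).toNat : ℤ)) = r.num := by omega
  have h2 : (((r.den - 1 : ℕ) : ℚ) + 1) = (r.den : ℚ) := by
    have := r.den_pos
    exact_mod_cast Nat.sub_add_cancel this
  have h3 : (((r.num.toNat : ℕ) : ℚ) - (((-r.num).toNat : ℕ) : ℚ)) = (r.num : ℚ) := by
    exact_mod_cast h1
  simp only [RatCode.val, h2, h3]
  exact Rat.num_div_den r

/-- `t : Ω → [0, ∞]` is lower semicomputable: there is an algorithm that, given a rational `r`,
enumerates intervals whose union is `{ω | r < t ω}`. The predicate `W r x` says that the interval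
`xΩ` is enumerated on input `r`. -/
def LowerSemicomputable (t : Cantor → ℝ≥0∞) : Prop :=
  ∃ W : RatCode → List Bool → Prop,
    REPred (fun p : RatCode × List Bool => W p.1 p.2) ∧
    ∀ (r : RatCode) (ω : Cantor),
      (((r.val : ℝ) : EReal) < (t ω : EReal)) ↔ ∃ x, W r x ∧ ω ∈ cylinder x

/-- A finite list of conditions `u < P(y) < v`, each given by a word `y` and rationals `u, v`. -/
abbrev MeasureConditions : Type := List (List Bool × RatCode × RatCode)

/-- The basic set (open interval) of probability measures on `Ω` given by finitely many
conditions `u < P(yΩ) < v`. -/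
def measureInterval (β : MeasureConditions) : Set (ProbabilityMeasure Cantor) :=
  {P | ∀ c ∈ β, ((c.2.1.val : ℝ) < (P (cylinder c.1) : ℝ)) ∧
    ((P (cylinder c.1) : ℝ) < (c.2.2.val : ℝ))}

/-- `t : Ω × M(Ω) → [0, ∞]` is lower semicomputable: there is an algorithm that, given a rational
`r`, enumerates basic open sets `xΩ × β` whose union is `{(ω, P) | r < t(ω, P)}`. -/
def LowerSemicomputable₂ (t : Cantor → ProbabilityMeasure Cantor → ℝ≥0∞) : Prop :=
  ∃ W : RatCode → List Bool → MeasureConditions → Prop,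
    REPred (fun p : RatCode × List Bool × MeasureConditions => W p.1 p.2.1 p.2.2) ∧
    ∀ (r : RatCode) (ω : Cantor) (P : ProbabilityMeasure Cantor),
      (((r.val : ℝ) : EReal) < (t ω P : EReal)) ↔
        ∃ x β, W r x β ∧ ω ∈ cylinder x ∧ P ∈ measureInterval β

/-- Blind (oracle-free) tests for `P`. -/
def IsBlindTest (P : ProbabilityMeasure Cantor) (t : Cantor → ℝ≥0∞) : Prop :=
  LowerSemicomputable t ∧ ∫⁻ ω, t ω ∂(P : Measure Cantor) ≤ 1

/-- `ω` is blindly random with respect to `P`: all blind tests for `P` are finite on `ω`. -/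
def BlindlyRandom (P : ProbabilityMeasure Cantor) (ω : Cantor) : Prop :=
  ∀ t, IsBlindTest P t → t ω < ∞

/-- Uniform randomness tests. -/
def IsUniformTest (t : Cantor → ProbabilityMeasure Cantor → ℝ≥0∞) : Prop :=
  LowerSemicomputable₂ t ∧
    ∀ P : ProbabilityMeasure Cantor, ∫⁻ ω, t ω P ∂(P : Measure Cantor) ≤ 1

/-- `ω` is uniformly random with respect to `P`: all uniform tests are finite at `(ω, P)`. For any
universal uniform test `u` this says `u ω P < ∞`, see `uniformlyRandom_iff_of_universal`. -/
def UniformlyRandom (P : ProbabilityMeasure Cantor) (ω : Cantor) : Prop :=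
  ∀ t, IsUniformTest t → t ω P < ∞

/-- Universal uniform tests: maximal up to a constant factor. -/
def IsUniversalUniformTest (u : Cantor → ProbabilityMeasure Cantor → ℝ≥0∞) : Prop :=
  IsUniformTest u ∧ ∀ t, IsUniformTest t → ∃ c : ℝ≥0, ∀ ω P, t ω P ≤ c * u ω P

theorem uniformlyRandom_iff_of_universal {u : Cantor → ProbabilityMeasure Cantor → ℝ≥0∞}
    (hu : IsUniversalUniformTest u) (P : ProbabilityMeasure Cantor) (ω : Cantor) :
    UniformlyRandom P ω ↔ u ω P < ∞ := by
  refine ⟨fun h => h u hu.1, fun h t ht => ?_⟩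
  obtain ⟨c, hc⟩ := hu.2 t ht
  exact (hc ω P).trans_lt (ENNReal.mul_lt_top ENNReal.coe_lt_top h)

end AlgRand

namespace AlgRand

open Filter Topology

/-! ### Words and cylinders -/

/-! A uniform test may read the measure, while a blind test may not; so the measure is made to
encode the sequence. Take atomless probability measures `ν₀`, `ν₁` giving the words starting with 1
mass 0 and 1, and put `μ_a = (1 - a) ν₀ + a ν₁`, so that `a` is the mass of `cylinder [true]`. For
`a` in `[1/4, 3/4]` every blind test for `μ_a` has finite integral against `ν₀ + ν₁`. There are only
countably many lower semicomputable functions, so almost every `ω` is blindly random for all these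
`μ_a` at once (`ae_forall_lowerSemicomputable_lt_top`). Fix such an `ω` and only then let `a` code
it in base 4. The test `codeTest` decodes prefixes from `P[1]` and rewards sequences agreeing with a
decoded prefix of small measure. As `μ_a` has no atoms, it is infinite at `ω`. -/

/-- The prefix of length `n` of a sequence. -/
def wordPrefix (ω : Cantor) (n : ℕ) : List Bool := (List.range n).map ω

@[simp] theorem length_wordPrefix (ω : Cantor) (n : ℕ) : (wordPrefix ω n).length = n := by
  simp [wordPrefix]

theorem mem_cylinder_wordPrefix {ω ω' : Cantor} {n : ℕ} :
    ω' ∈ cylinder (wordPrefix ω n) ↔ ∀ i < n, ω' i = ω i := by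
  simp [cylinder, wordPrefix]

theorem eq_wordPrefix_of_mem_cylinder {ω : Cantor} {x : List Bool} (h : ω ∈ cylinder x) :
    x = wordPrefix ω x.length := by
  apply List.ext_getElem
  · simp
  · intro i h1 h2
    simp [wordPrefix, h i h1]

theorem isOpen_cylinder (x : List Bool) : IsOpen (cylinder x) := by
  have : cylinder x = ⋂ i : Fin x.length, (fun ω : Cantor => ω i) ⁻¹' {x[i]} := by
    ext ω
    simp only [cylinder, Set.mem_ofPred_eq, Set.mem_iInter, Set.mem_preimage,
      Set.mem_singleton_iff]
    exact ⟨fun h i => h i i.2, fun h i hi => h ⟨i, hi⟩⟩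
  rw [this]
  exact isOpen_iInter_of_finite fun i => (isOpen_discrete _).preimage (continuous_apply _)

theorem measurableSet_cylinder (x : List Bool) : MeasurableSet (cylinder x) :=
  (isOpen_cylinder x).measurableSet

theorem tendsto_measure_cylinder_wordPrefix (μ : Measure Cantor) [IsFiniteMeasure μ] [NullSingletonClass μ]
    (ω : Cantor) : Tendsto (fun n => μ (cylinder (wordPrefix ω n))) atTop (𝓝 0) := by
  have h := tendsto_measure_iInter_atTop (μ := μ) (s := fun n => cylinder (wordPrefix ω n))
    (fun n => (measurableSet_cylinder _).nullMeasurableSet)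
    (fun m n hmn ω' h => mem_cylinder_wordPrefix.2 fun i hi =>
      mem_cylinder_wordPrefix.1 h i (hi.trans_le hmn)) ⟨0, measure_ne_top _ _⟩
  have h' : ⋂ n, cylinder (wordPrefix ω n) = {ω} := by
    ext ω'
    simp only [Set.mem_iInter, mem_cylinder_wordPrefix, Set.mem_singleton_iff]
    exact ⟨fun h => funext fun i => h (i + 1) i i.lt_succ_self, fun h _ i _ => h ▸ rfl⟩
  rwa [h', measure_singleton] at h

/-! ### Lower semicomputable functions -/

theorem exists_ratCode_btwn {a b : EReal} (h : a < b) :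
    ∃ r : RatCode, a < ((r.val : ℝ) : EReal) ∧ ((r.val : ℝ) : EReal) < b := by
  obtain ⟨q, h1, h2⟩ := EReal.lt_iff_exists_rat_btwn.1 h
  obtain ⟨r, rfl⟩ := RatCode.val_surjective q
  exact ⟨r, h1, h2⟩

theorem LowerSemicomputable.lowerSemicontinuous {t : Cantor → ℝ≥0∞}
    (ht : LowerSemicomputable t) : LowerSemicontinuous t := by
  obtain ⟨W, -, hW⟩ := ht
  intro ω y hy
  obtain ⟨r, h1, h2⟩ := exists_ratCode_btwn (EReal.coe_ennreal_lt_coe_ennreal_iff.2 hy)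
  obtain ⟨x, hx, hωx⟩ := (hW r ω).1 h2
  filter_upwards [(isOpen_cylinder x).mem_nhds hωx] with ω' hω'
  exact EReal.coe_ennreal_lt_coe_ennreal_iff.1 (h1.trans ((hW r ω').2 ⟨x, hx, hω'⟩))

/-- A predicate is the domain of its semi-decision procedure, and there are countably many partial
recursive functions. -/
theorem countable_setOf_rePred {α : Type*} [Primcodable α] :
    {p : α → Prop | REPred p}.Countable := by
  let F : {p : α → Prop | REPred p} → {f : ℕ →. ℕ // Partrec f} := fun p =>
    ⟨fun n => Part.bind (Part.ofOption (Encodable.decode (α := α) n)) fun a =>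
      (Part.assert (p.1 a) fun _ => Part.some ()).map Encodable.encode,
      by
      have h : REPred p.1 := p.2
      exact Partrec.nat_iff.2 h⟩
  have hF : Function.Injective F := by
    rintro ⟨p, hp⟩ ⟨q, hq⟩ h
    ext a
    have h1 := congrFun (congrArg Subtype.val h) (Encodable.encode a)
    have h2 := congrArg Part.Dom h1
    simpa [F, Part.assert] using h2
  exact hF.countable

/-- The enumeration determines the function, since rationals separate distinct values. -/
theorem countable_setOf_lowerSemicomputable : {t | LowerSemicomputable t}.Countable := by
  have key : ∀ t : {t | LowerSemicomputable t}, ∃ p : {p : RatCode × List Bool → Prop | REPred p},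
      ∀ (r : RatCode) (ω : Cantor),
        (((r.val : ℝ) : EReal) < (t.1 ω : EReal)) ↔ ∃ x, p.1 (r, x) ∧ ω ∈ cylinder x := by
    rintro ⟨t, W, h1, h2⟩
    exact ⟨⟨_, h1⟩, h2⟩
  choose F hF using key
  have := (countable_setOf_rePred (α := RatCode × List Bool)).to_subtype
  have hle : ∀ s t, F s = F t → ∀ ω, s.1 ω ≤ t.1 ω := by
    intro s t h ω
    by_contra! hlt
    obtain ⟨r, h1, h2⟩ := exists_ratCode_btwn (EReal.coe_ennreal_lt_coe_ennreal_iff.2 hlt)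
    have h3 := (hF s r ω).1 h2
    rw [h] at h3
    exact lt_asymm h1 ((hF t r ω).2 h3)
  have hinj : Function.Injective F := fun s t h =>
    Subtype.ext (funext fun ω => le_antisymm (hle s t h ω) (hle t s h.symm ω))
  exact hinj.countable

theorem ae_forall_lowerSemicomputable_lt_top (μ : Measure Cantor) :
    ∀ᵐ ω ∂μ, ∀ t, LowerSemicomputable t → ∫⁻ ω, t ω ∂μ ≠ ∞ → t ω < ∞ := by
  have h := (ae_ball_iff (μ := μ) (p := fun ω t _ => ∫⁻ ω, t ω ∂μ ≠ ∞ → t ω < ∞)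
    countable_setOf_lowerSemicomputable).2 fun t ht => by
      by_cases hi : ∫⁻ ω, t ω ∂μ = ∞
      · simp [hi]
      · filter_upwards [ae_lt_top ht.lowerSemicontinuous.measurable hi] with ω hω _ using hω
  exact h

/-! ### Coding a sequence in a real number -/

/-- The number with base `4` digits `1 + x₀, 1 + x₁, …`. -/
def wordCode (x : List Bool) : ℕ := x.foldl (fun k b => 4 * k + 1 + b.toNat) 0

/-- The code of the prefix of length `n`. -/
def prefixCode (ω : Cantor) (n : ℕ) : ℕ := wordCode (wordPrefix ω n)

@[simp] theorem prefixCode_zero (ω : Cantor) : prefixCode ω 0 = 0 := rfl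

theorem prefixCode_succ (ω : Cantor) (n : ℕ) :
    prefixCode ω (n + 1) = 4 * prefixCode ω n + 1 + (ω n).toNat := by
  simp [prefixCode, wordCode, wordPrefix, List.range_succ]

theorem eq_of_prefixCode_eq {ω ω' : Cantor} {n : ℕ} (h : prefixCode ω n = prefixCode ω' n) :
    ∀ i < n, ω i = ω' i := by
  induction n with
  | zero => simp
  | succ n ih =>
    rw [prefixCode_succ, prefixCode_succ] at h
    have h1 := Bool.toNat_le (ω n)
    have h2 := Bool.toNat_le (ω' n)
    intro i hi
    rcases Nat.lt_succ_iff_lt_or_eq.1 hi with hi | rfl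
    · exact ih (by omega) i hi
    · have h3 : (ω i).toNat = (ω' i).toNat := by omega
      revert h3
      cases ω i <;> cases ω' i <;> simp

/-- The real numbers that code a sequence agreeing with `ω` up to `n` lie in this interval. -/
def codeInterval (ω : Cantor) (n : ℕ) : Set ℝ :=
  Set.Ioo ((prefixCode ω n : ℝ) / 4 ^ n) (((prefixCode ω n : ℝ) + 1) / 4 ^ n)

/-- Digits 0 and 3 never occur, so the code intervals shrink strictly at both ends. The coding real
thus lies in the open intervals, which basic sets of measures can express. -/
theorem prefixCode_div_lt_succ (ω : Cantor) (n : ℕ) :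
    (prefixCode ω n : ℝ) / 4 ^ n < (prefixCode ω (n + 1) : ℝ) / 4 ^ (n + 1) := by
  have : (0 : ℝ) ≤ (ω n).toNat := by positivity
  rw [div_lt_div_iff₀ (by positivity) (by positivity), prefixCode_succ, pow_succ]
  push_cast
  have : (0 : ℝ) < 4 ^ n := by positivity
  nlinarith

theorem prefixCode_add_one_div_succ_lt (ω : Cantor) (n : ℕ) :
    ((prefixCode ω (n + 1) : ℝ) + 1) / 4 ^ (n + 1) < ((prefixCode ω n : ℝ) + 1) / 4 ^ n := by
  have : ((ω n).toNat : ℝ) ≤ 1 := by exact_mod_cast Bool.toNat_le (ω n)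
  rw [div_lt_div_iff₀ (by positivity) (by positivity), prefixCode_succ, pow_succ]
  push_cast
  have : (0 : ℝ) < 4 ^ n := by positivity
  nlinarith

theorem antitone_codeInterval (ω : Cantor) : Antitone (codeInterval ω) :=
  antitone_nat_of_succ_le fun n => Set.Ioo_subset_Ioo (prefixCode_div_lt_succ ω n).le
    (prefixCode_add_one_div_succ_lt ω n).le

/-- Open base-4 intervals of equal length with distinct integer codes are disjoint. -/
theorem eq_of_mem_codeInterval {ω ω' : Cantor} {m n : ℕ} {a : ℝ} (hmn : m ≤ n)
    (h : a ∈ codeInterval ω m) (h' : a ∈ codeInterval ω' n) : ∀ i < m, ω i = ω' i := by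
  have h'' := antitone_codeInterval ω' hmn h'
  simp only [codeInterval, Set.mem_Ioo, div_lt_iff₀ (show (0 : ℝ) < 4 ^ m by positivity),
    lt_div_iff₀ (show (0 : ℝ) < 4 ^ m by positivity)] at h h''
  have h1 : (prefixCode ω m : ℝ) < prefixCode ω' m + 1 := by linarith
  have h2 : (prefixCode ω' m : ℝ) < prefixCode ω m + 1 := by linarith
  norm_cast at h1 h2
  exact eq_of_prefixCode_eq (by omega)

theorem exists_mem_codeInterval (ω : Cantor) :
    ∃ a ∈ Set.Icc (1 / 4 : ℝ) (3 / 4), ∀ n, a ∈ codeInterval ω n := by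
  have hmono : Monotone fun n => (prefixCode ω n : ℝ) / 4 ^ n :=
    monotone_nat_of_le_succ fun n => (prefixCode_div_lt_succ ω n).le
  have hanti : Antitone fun n => ((prefixCode ω n : ℝ) + 1) / 4 ^ n :=
    antitone_nat_of_succ_le fun n => (prefixCode_add_one_div_succ_lt ω n).le
  have hmem := hmono.ciSup_mem_iInter_Icc_of_antitone hanti fun n =>
    div_le_div_of_nonneg_right (by linarith) (by positivity)
  rw [Set.mem_iInter] at hmem
  refine ⟨_, ?_, fun n => ⟨(prefixCode_div_lt_succ ω n).trans_le (hmem (n + 1)).1,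
    (hmem (n + 1)).2.trans_lt (prefixCode_add_one_div_succ_lt ω n)⟩⟩
  -- The first digit is 1 or 2, which gives the bounds 1/4 and 3/4.
  have h1 := hmem 1
  have h2 : ((ω 0).toNat : ℝ) ≤ 1 := by exact_mod_cast Bool.toNat_le (ω 0)
  have h3 : (0 : ℝ) ≤ (ω 0).toNat := by positivity
  simp only [prefixCode_succ, prefixCode_zero] at h1
  push_cast at h1
  exact ⟨by linarith [h1.1], by linarith [h1.2]⟩

/-! ### A uniform test -/

/-- The level sets of the test: `P[1]` codes a sequence agreeing with `ω` up to some `m`, and the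
prefix of `ω` of length `m` has small `P`-measure. -/
def TestLevel (ω : Cantor) (P : ProbabilityMeasure Cantor) (n : ℕ) : Prop :=
  n = 0 ∨ ∃ m, (P (cylinder [true]) : ℝ) ∈ codeInterval ω m ∧
    (P (cylinder (wordPrefix ω m)) : ℝ) < 1 / 4 ^ n

theorem TestLevel.mono {ω : Cantor} {P : ProbabilityMeasure Cantor} {m n : ℕ} (hmn : m ≤ n)
    (h : TestLevel ω P n) : TestLevel ω P m := by
  rcases h with rfl | ⟨k, hk, hk'⟩
  · exact Or.inl (by omega)
  · exact Or.inr ⟨k, hk, hk'.trans_le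
      (one_div_le_one_div_of_le (by positivity) (pow_le_pow_right₀ (by norm_num) hmn))⟩

/-- The largest level of `(ω, P)`. -/
noncomputable def codeTest (ω : Cantor) (P : ProbabilityMeasure Cantor) : ℝ≥0∞ :=
  ⨆ (n : ℕ) (_ : TestLevel ω P n), (n : ℝ≥0∞)

/-- The least natural number greater than a given rational. -/
def RatCode.level (r : RatCode) : ℕ :=
  if r.1 < r.2.1 then 0 else (r.1 - r.2.1) / (r.2.2 + 1) + 1

theorem RatCode.val_neg_iff (r : RatCode) : r.val < 0 ↔ r.1 < r.2.1 := by
  rw [RatCode.val, div_lt_iff₀ (by positivity)]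
  simp

theorem RatCode.val_lt_natCast_iff (r : RatCode) (n : ℕ) (h : ¬ r.1 < r.2.1) :
    r.val < n ↔ r.level ≤ n := by
  rw [RatCode.level, if_neg h, Nat.succ_le_iff, Nat.div_lt_iff_lt_mul (Nat.succ_pos _),
    RatCode.val, div_lt_iff₀ (by positivity)]
  rw [← Nat.cast_lt (α := ℚ), Nat.cast_sub (not_lt.1 h)]
  push_cast
  rfl

/-- The test takes values in the naturals and infinity, and levels are downward closed. Level 0
always holds, which settles negative rationals. -/
theorem lt_codeTest_iff (r : RatCode) (ω : Cantor) (P : ProbabilityMeasure Cantor) :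
    (((r.val : ℝ) : EReal) < (codeTest ω P : EReal)) ↔ TestLevel ω P r.level := by
  by_cases h : r.1 < r.2.1
  · have h1 : r.level = 0 := by simp [RatCode.level, h]
    have h2 : ((r.val : ℝ) : EReal) < 0 := by exact_mod_cast (r.val_neg_iff).2 h
    simp only [h1, TestLevel, true_or, iff_true]
    exact h2.trans_le (EReal.coe_ennreal_nonneg _)
  · have h0 : (0 : ℝ) ≤ r.val := by
      exact_mod_cast not_lt.1 fun h' => h ((r.val_neg_iff).1 h')
    have h1 : ((r.val : ℝ) : EReal) = (ENNReal.ofReal r.val : EReal) := by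
      rw [EReal.coe_ennreal_ofReal, max_eq_left h0]
    rw [h1, EReal.coe_ennreal_lt_coe_ennreal_iff]
    simp only [codeTest, lt_iSup_iff]
    have h2 : ∀ n : ℕ, ENNReal.ofReal r.val < n ↔ r.level ≤ n := fun n => by
      rw [← r.val_lt_natCast_iff n h, ← ENNReal.ofReal_natCast,
        ENNReal.ofReal_lt_ofReal_iff_of_nonneg h0]
      exact_mod_cast Iff.rfl
    constructor
    · rintro ⟨n, hn, hn'⟩
      exact hn.mono ((h2 n).1 hn')
    · exact fun hn => ⟨_, hn, (h2 _).2 le_rfl⟩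

/-- The conditions on `P` that certify level `n` for the sequences beginning with `x`. -/
def levelConditions (n : ℕ) (x : List Bool) : MeasureConditions :=
  if n = 0 then [] else
    [([true], (wordCode x, 0, 4 ^ x.length - 1), (wordCode x + 1, 0, 4 ^ x.length - 1)),
      -- Conditions are two-sided and strict; the lower bound -1 is vacuous and admits measure 0.
      (x, (0, 1, 0), (1, 0, 4 ^ n - 1))]

theorem RatCode.val_pow (k n : ℕ) : RatCode.val (k, 0, 4 ^ n - 1) = (k : ℚ) / 4 ^ n := by
  simp [RatCode.val, Nat.cast_sub (Nat.one_le_pow n 4 (by norm_num))]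

theorem testLevel_iff (ω : Cantor) (P : ProbabilityMeasure Cantor) (n : ℕ) :
    TestLevel ω P n ↔ ∃ x, ω ∈ cylinder x ∧ P ∈ measureInterval (levelConditions n x) := by
  by_cases hn : n = 0
  · simp only [TestLevel, hn, levelConditions, true_or, true_iff]
    exact ⟨[], by simp [cylinder], by simp [measureInterval]⟩
  · have key : ∀ m, P ∈ measureInterval (levelConditions n (wordPrefix ω m)) ↔
        (P (cylinder [true]) : ℝ) ∈ codeInterval ω m ∧
          (P (cylinder (wordPrefix ω m)) : ℝ) < 1 / 4 ^ n := by
      intro m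
      have h0 : (-1 : ℝ) < (P (cylinder (wordPrefix ω m)) : ℝ) :=
        lt_of_lt_of_le (by norm_num) NNReal.zero_le_coe
      have h1 : (RatCode.val (0, 1, 0) : ℝ) = -1 := by simp [RatCode.val]
      simp only [measureInterval, levelConditions, hn, if_false, Set.mem_ofPred_eq,
        List.forall_mem_cons, RatCode.val_pow, length_wordPrefix, codeInterval, Set.mem_Ioo, h1,
        prefixCode]
      push_cast
      simp [h0]
    simp only [TestLevel, hn, false_or]
    constructor
    · rintro ⟨m, h⟩
      exact ⟨wordPrefix ω m, mem_cylinder_wordPrefix.2 fun _ _ => rfl, (key m).2 h⟩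
    · rintro ⟨x, hx, h⟩
      rw [eq_wordPrefix_of_mem_cylinder hx] at h
      exact ⟨_, (key _).1 h⟩

theorem primrec_wordCode : Primrec wordCode := by
  refine Primrec.list_foldl (h := fun (_ : List Bool) (p : ℕ × Bool) => 4 * p.1 + 1 + p.2.toNat)
    Primrec.id (Primrec.const 0) ?_
  have hb : Primrec Bool.toNat := Primrec.dom_finite _
  exact Primrec.nat_add.comp (Primrec.nat_add.comp
    (Primrec.nat_mul.comp (Primrec.const 4) (Primrec.fst.comp Primrec.snd)) (Primrec.const 1))
    (hb.comp (Primrec.snd.comp Primrec.snd))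

theorem primrec_four_pow_sub_one : Primrec fun n : ℕ => 4 ^ n - 1 :=
  Primrec.nat_sub.comp ((Primrec₂.unpaired'.1 Nat.Primrec.pow).comp (Primrec.const 4) Primrec.id)
    (Primrec.const 1)

theorem primrec_level : Primrec RatCode.level := by
  have h1 : Primrec fun r : RatCode => r.1 := Primrec.fst
  have h2 : Primrec fun r : RatCode => r.2.1 := Primrec.fst.comp Primrec.snd
  have h3 : Primrec fun r : RatCode => r.2.2 := Primrec.snd.comp Primrec.snd
  exact Primrec.ite (Primrec.nat_lt.comp h1 h2) (Primrec.const 0)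
    (Primrec.succ.comp (Primrec.nat_div.comp (Primrec.nat_sub.comp h1 h2) (Primrec.succ.comp h3)))

theorem primrec_levelConditions : Primrec₂ levelConditions := by
  have hx : Primrec fun p : ℕ × List Bool => p.2 := Primrec.snd
  have hk := primrec_wordCode.comp hx
  have hl := primrec_four_pow_sub_one.comp (Primrec.list_length.comp hx)
  have hn := primrec_four_pow_sub_one.comp (Primrec.fst : Primrec fun p : ℕ × List Bool => p.1)
  have z : Primrec fun _ : ℕ × List Bool => 0 := Primrec.const 0
  exact Primrec.ite (Primrec.eq.comp Primrec.fst z) (Primrec.const [])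
    (Primrec.list_cons.comp
      ((Primrec.const [true]).pair ((hk.pair (z.pair hl)).pair
        ((Primrec.succ.comp hk).pair (z.pair hl))))
      (Primrec.list_cons.comp
        (hx.pair ((Primrec.const (0, 1, 0)).pair ((Primrec.const 1).pair (z.pair hn))))
        (Primrec.const [])))

theorem lowerSemicomputable₂_codeTest : LowerSemicomputable₂ codeTest := by
  refine ⟨fun r x β => β = levelConditions r.level x, ?_, fun r ω P => ?_⟩
  · refine ComputablePred.to_re (PrimrecPred.computablePred ?_)
    exact Primrec.eq.comp (Primrec.snd.comp Primrec.snd)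
      (primrec_levelConditions.comp (primrec_level.comp Primrec.fst)
        (Primrec.fst.comp Primrec.snd))
  · rw [lt_codeTest_iff, testLevel_iff]
    constructor
    · rintro ⟨x, h1, h2⟩
      exact ⟨x, _, rfl, h1, h2⟩
    · rintro ⟨x, _, rfl, h1, h2⟩
      exact ⟨x, h1, h2⟩

/-- Let `m` be the shortest length witnessing the level. Any other witness is at least as long and
decodes from the same real `P[1]`, so it shares the prefix of length `m`: one small cylinder covers
the level. -/
theorem exists_measurable_cover_testLevel (P : ProbabilityMeasure Cantor) (n : ℕ) :
    ∃ C : Set Cantor, MeasurableSet C ∧ (P : Measure Cantor) C ≤ 1 / 4 ^ (n + 1) ∧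
      ∀ ω, TestLevel ω P (n + 1) → ω ∈ C := by
  classical
  by_cases h : ∃ m ω, (P (cylinder [true]) : ℝ) ∈ codeInterval ω m ∧
    (P (cylinder (wordPrefix ω m)) : ℝ) < 1 / 4 ^ (n + 1)
  · obtain ⟨ω, h1, h2⟩ := Nat.find_spec h
    refine ⟨_, measurableSet_cylinder (wordPrefix ω (Nat.find h)), ?_, ?_⟩
    · rw [← ProbabilityMeasure.ennreal_coeFn_eq_coeFn_toMeasure]
      have h3 : P (cylinder (wordPrefix ω (Nat.find h))) ≤ (1 / 4 ^ (n + 1) : ℝ≥0) := by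
        rw [← NNReal.coe_le_coe]
        push_cast
        exact h2.le
      refine (ENNReal.coe_le_coe.2 h3).trans_eq ?_
      rw [ENNReal.coe_div (by positivity)]
      simp
    · rintro ω' (h' | ⟨m, hm, hm'⟩)
      · omega
      · have hle := Nat.find_min' h ⟨ω', hm, hm'⟩
        exact mem_cylinder_wordPrefix.2 fun i hi => (eq_of_mem_codeInterval hle h1 hm i hi).symm
  · refine ⟨∅, MeasurableSet.empty, by simp, ?_⟩
    rintro ω (h' | ⟨m, hm⟩)
    · omega
    · exact h ⟨m, ω, hm⟩

theorem lintegral_codeTest_le_one (P : ProbabilityMeasure Cantor) :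
    ∫⁻ ω, codeTest ω P ∂(P : Measure Cantor) ≤ 1 := by
  choose C hC hPC hCt using exists_measurable_cover_testLevel P
  calc ∫⁻ ω, codeTest ω P ∂(P : Measure Cantor)
      ≤ ∫⁻ ω, ∑' n : ℕ, (C n).indicator (fun _ => ((n + 1 : ℕ) : ℝ≥0∞)) ω
          ∂(P : Measure Cantor) := by
        refine lintegral_mono fun ω => iSup₂_le fun n hn => ?_
        rcases n with _ | n
        · simp
        · refine le_trans (le_of_eq ?_) (ENNReal.le_tsum n)
          rw [Set.indicator_of_mem (hCt n ω hn)]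
    _ = ∑' n : ℕ, ((n + 1 : ℕ) : ℝ≥0∞) * (P : Measure Cantor) (C n) := by
        rw [lintegral_tsum fun n => (measurable_const.indicator (hC n)).aemeasurable]
        exact tsum_congr fun n => lintegral_indicator_const (hC n) _
    -- Uses `n + 1 ≤ 2 ^ (n + 1)` against the bound `1 / 4 ^ (n + 1)`.
    _ ≤ ∑' n : ℕ, (2⁻¹ : ℝ≥0∞) ^ (n + 1) := by
        refine ENNReal.tsum_le_tsum fun n => ?_
        have h2 : ((n + 1 : ℕ) : ℝ≥0∞) ≤ 2 ^ (n + 1) := by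
          exact_mod_cast (Nat.lt_two_pow_self (n := n + 1)).le
        calc _ ≤ (2 : ℝ≥0∞) ^ (n + 1) * (1 / 4 ^ (n + 1)) := by gcongr; exact hPC n
          _ = _ := by
            rw [show (4 : ℝ≥0∞) = 2 * 2 by norm_num, mul_pow, one_div,
              ENNReal.mul_inv (by simp) (by simp), ← mul_assoc,
              ENNReal.mul_inv_cancel (by simp) (by simp), one_mul, ENNReal.inv_pow]
    _ = 1 := by
        rw [ENNReal.tsum_geometric_add_one, ENNReal.one_sub_inv_two, inv_inv,
          ENNReal.inv_mul_cancel (by simp) (by simp)]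

theorem isUniformTest_codeTest : IsUniformTest codeTest :=
  ⟨lowerSemicomputable₂_codeTest, lintegral_codeTest_le_one⟩

theorem codeTest_eq_top {P : ProbabilityMeasure Cantor} [NullSingletonClass (P : Measure Cantor)]
    {ω : Cantor} (h : ∀ n, (P (cylinder [true]) : ℝ) ∈ codeInterval ω n) :
    codeTest ω P = ∞ := by
  have key : ∀ n, TestLevel ω P n := by
    intro n
    have hlim := (ENNReal.tendsto_toReal ENNReal.zero_ne_top).comp
      (tendsto_measure_cylinder_wordPrefix (P : Measure Cantor) ω)
    obtain ⟨m, hm⟩ := (hlim.eventually_lt_const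
      (show (0 : ℝ≥0∞).toReal < 1 / 4 ^ n by simp)).exists
    exact Or.inr ⟨m, h m, hm⟩
  simp only [codeTest, key, iSup_pos]
  exact ENNReal.iSup_natCast

/-! ### The measures -/

/-- Prepend a bit to a sequence. -/
def cons (b : Bool) (ω : Cantor) : Cantor := fun n => Nat.casesOn n b ω

theorem measurable_cons (b : Bool) : Measurable (cons b) := by
  refine measurable_pi_iff.2 fun n => ?_
  cases n with
  | zero => exact measurable_const
  | succ n => exact measurable_pi_apply n

theorem cons_injective (b : Bool) : Function.Injective (cons b) := fun _ _ h =>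
  funext fun n => congrFun h (n + 1)

theorem exists_isProbabilityMeasure_nullSingletonClass :
    ∃ ν : Measure Cantor, IsProbabilityMeasure ν ∧ NullSingletonClass ν := by
  have hc : ¬ Countable Cantor := by
    rw [← Cardinal.mk_le_aleph0_iff]
    simpa using Cardinal.cantor Cardinal.aleph0
  have hr : ¬ Countable ℝ := by
    rw [not_countable_iff]; infer_instance
  let e : ℝ ≃ᵐ Cantor := PolishSpace.measurableEquivOfNotCountable hr hc
  refine ⟨(volume.restrict (Set.Icc (0 : ℝ) 1)).map e, ?_, ⟨fun ω => ?_⟩⟩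
  · have : IsProbabilityMeasure (volume.restrict (Set.Icc (0 : ℝ) 1)) := ⟨by simp⟩
    exact Measure.isProbabilityMeasure_map e.measurable.aemeasurable
  · rw [Measure.map_apply e.measurable (measurableSet_singleton _)]
    exact (Set.Subsingleton.preimage Set.subsingleton_singleton e.injective).measure_zero _

/-- Prepending a fixed bit is injective, so it preserves atomlessness while deciding the first bit.
-/
theorem exists_atomless_measure_cylinder (b : Bool) :
    ∃ ν : Measure Cantor, IsProbabilityMeasure ν ∧ NullSingletonClass ν ∧
      ν (cylinder [true]) = if b then 1 else 0 := by
  obtain ⟨ν, h1, h2⟩ := exists_isProbabilityMeasure_nullSingletonClass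
  refine ⟨ν.map (cons b), Measure.isProbabilityMeasure_map (measurable_cons b).aemeasurable,
    ⟨fun ω => ?_⟩, ?_⟩
  · rw [Measure.map_apply (measurable_cons b) (measurableSet_singleton _)]
    exact (Set.Subsingleton.preimage Set.subsingleton_singleton (cons_injective b)).measure_zero _
  · rw [Measure.map_apply (measurable_cons b) (measurableSet_cylinder _)]
    have : cons b ⁻¹' cylinder [true] = {_ω | b = true} := by
      ext ω
      simp [cylinder, cons]
    rw [this]
    cases b <;> simp

theorem exists_blindlyRandom_not_uniformlyRandom :
    ∃ (P : ProbabilityMeasure Cantor) (ω : Cantor),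
      BlindlyRandom P ω ∧ ¬ UniformlyRandom P ω := by
  obtain ⟨ν₀, _, _, h₀⟩ := exists_atomless_measure_cylinder false
  obtain ⟨ν₁, _, _, h₁⟩ := exists_atomless_measure_cylinder true
  have hne : ae (ν₀ + ν₁) ≠ ⊥ := by
    rw [Ne, ae_eq_bot]
    intro h
    simpa [h₁] using congrArg (fun μ : Measure Cantor => μ (cylinder [true])) h
  have : (ae (ν₀ + ν₁)).NeBot := ⟨hne⟩
  -- The choice of `ω` involves only `ν₀ + ν₁`, so `a` may depend on `ω` without circularity.
  obtain ⟨ω, hω⟩ := (ae_forall_lowerSemicomputable_lt_top (ν₀ + ν₁)).exists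
  obtain ⟨a, ⟨ha, ha'⟩, hmem⟩ := exists_mem_codeInterval ω
  let μ : Measure Cantor := ENNReal.ofReal (1 - a) • ν₀ + ENNReal.ofReal a • ν₁
  have hμ : IsProbabilityMeasure μ := ⟨by
    simp only [μ, Measure.add_apply, Measure.smul_apply, measure_univ, smul_eq_mul, mul_one]
    rw [← ENNReal.ofReal_add (by linarith) (by linarith)]
    simp⟩
  have hat : NullSingletonClass μ := ⟨fun ω => by simp [μ]⟩
  -- Both weights `1 - a` and `a` are at least 1/4.
  have hle : ∀ t : Cantor → ℝ≥0∞,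
      ENNReal.ofReal (1 / 4) * ∫⁻ ω, t ω ∂(ν₀ + ν₁) ≤ ∫⁻ ω, t ω ∂μ := by
    intro t
    simp only [μ, lintegral_add_measure, lintegral_smul_measure, smul_eq_mul, mul_add]
    gcongr
    linarith
  let P : ProbabilityMeasure Cantor := ⟨μ, hμ⟩
  have hP : (P (cylinder [true]) : ℝ) = a := by
    change (μ (cylinder [true])).toReal = a
    simp only [μ, Measure.add_apply, Measure.smul_apply, h₀, h₁]
    simp [show 0 ≤ a by linarith]
  have : NullSingletonClass (P : Measure Cantor) := hat
  refine ⟨P, ω, fun t ht => hω t ht.1 fun htop => ?_, fun h => ?_⟩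
  · have h1 := (hle t).trans ht.2
    rw [htop, ENNReal.mul_top (by simp)] at h1
    simp at h1
  · refine (h codeTest isUniformTest_codeTest).ne (codeTest_eq_top fun n => ?_)
    rw [hP]
    exact hmem n

end AlgRand

theorem mainTheorem8 :
    ∃ (P : MeasureTheory.ProbabilityMeasure AlgRand.Cantor) (ω : AlgRand.Cantor),
      AlgRand.BlindlyRandom P ω ∧ ¬ AlgRand.UniformlyRandom P ω := by
  exact AlgRand.exists_blindlyRandom_not_uniformlyRandom
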